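/- Let $n\ge 1$. A pointed partition of $[n]=\{1,\dots,n\}$ is a partition of $[n]$ together with the choice of one element (the pointed element) in each block. The set $\Pi^A_n$ of pointed partitions of $[n]$ is partially ordered by $\pi\le\nu$ if and only if the underlying partition of $\pi$ refines that of $\nu$ and every pointed element of $\nu$ is pointed in $\pi$. Its least element $\hat 0$ is the pointed partition into singletons. Theorem. Let $n\ge 1$, let $m$ be a maximal element of $\Pi^A_n$, and let $P=[\hat 0,m]$ be the corresponding maximal interval of $\Pi^A_n$ (all these intervals are isomorphic; they are denoted $\Pi^A_{n,1}$). Then 1. $P$ is totally semi-modular: it is finite and bounded, and for every closed interval $[x,y]$ of $P$ and all $t,u,v\in[x,y]$ such that $u\ne v$ both cover $t$ there is $z\in[x,y]$ that covers both $u$ and $v$. 2. $P$ is CL-shellable: it is graded (finite, bounded and pure) and admits a CL-labeling. That is, there are a poset $\Lambda$ and an assignment of a label in $\Lambda$ to each edge (covering pair) of each maximal chain of $P$, such that two maximal chains which coincide along their first $d$ edges have the same labels along these edges, and such that for all $x\le y$ in $P$ and every maximal chain $r$ of $[\hat 0,x]$ the following holds: among the maximal chains of $[x,y]$, with the words of labels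 that they receive as parts of maximal chains of $P$ beginning with $r$, exactly one has a weakly increasing word, and this word strictly precedes the words of all the other maximal chains of $[x,y]$ in the lexicographic order. 3. $P$ is Cohen–Macaulay over $\mathbb{Z}$ and over every field: it is graded and, for $R=\mathbb{Z}$ and for $R$ any field, for all $x<y$ in $P$, with $\Delta(x,y)$ the order complex of the open interval $(x,y)$, the reduced simplicial homology $\widetilde H_i(\Delta(x,y);R)$ is $0$ for all $i<\dim\Delta(x,y)$ (where $\dim\emptyset=-1$). -/

import Mathlib

/-! ### Finite posets: boundedness, gradedness, semimodularity -/

/-- A finite poset with a least element `0̂` and a greatest element `1̂`. -/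
structure IsFiniteBounded (P : Type*) [PartialOrder P] : Prop where
  finite : Finite P
  exists_bot : ∃ a : P, IsBot a
  exists_top : ∃ b : P, IsTop b

/-- A finite bounded poset is semimodular if any two distinct elements covering a common
element are covered by a common element. -/
structure IsSemimodular (P : Type*) [PartialOrder P] : Prop extends IsFiniteBounded P where
  exists_cover : ∀ t u v : P, u ≠ v → t ⋖ u → t ⋖ v → ∃ z : P, u ⋖ z ∧ v ⋖ z

/-- A finite bounded poset is totally semimodular if all its closed intervals `[x, y]` are
semimodular. -/
structure IsTotallySemimodular (P : Type*) [PartialOrder P] : Prop extends IsFiniteBounded P where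
  interval : ∀ x y : P, x ≤ y → IsSemimodular (Set.Icc x y)

/-- The list `c` is a chain `x = c₀ ⋖ c₁ ⋖ ⋯ ⋖ c_ℓ = y`. In a finite poset these are
exactly the maximal chains of the interval `[x, y]`. -/
structure IsMaxChainOf {P : Type*} [PartialOrder P] (x y : P) (c : List P) : Prop where
  head_eq : c.head? = some x
  last_eq : c.getLast? = some y
  covers : c.IsChain (· ⋖ ·)

/-- A graded poset: bounded and pure, i.e. for all `x ≤ y` all maximal chains between `x`
and `y` have the same length. -/
structure IsGraded (P : Type*) [PartialOrder P] : Prop extends IsFiniteBounded P where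
  pure : ∀ (x y : P) (c c' : List P), IsMaxChainOf x y c → IsMaxChainOf x y c' →
    c.length = c'.length

/-! ### CL-labelings -/

/-- The list `c` is a maximal chain of the bounded poset `P`. -/
def IsMaxChainIn {P : Type*} [PartialOrder P] (c : List P) : Prop :=
  ∃ a b : P, IsBot a ∧ IsTop b ∧ IsMaxChainOf a b c

/-- The labels of the `ℓ` consecutive edges number `d, d + 1, …, d + ℓ - 1` of the maximal
chain `c`. Here `lab c i` is the label of the edge `c_i ⋖ c_{i+1}` of `c`. -/
def labelWord {P Λ : Type*} (lab : List P → ℕ → Λ) (c : List P) (d ℓ : ℕ) : List Λ :=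
  (List.range ℓ).map fun i => lab c (d + i)

/-- The word `λ_r(m)` of the maximal chain `m` of a rooted interval `[x, y]_r`, where
`r` is a maximal chain of `[0̂, x]`. It is read off the maximal chain `r ∪ m ∪ s` of the poset,
where `s` is a maximal chain of `[y, 1̂]`. -/
def rootedWord {P Λ : Type*} (lab : List P → ℕ → Λ) (r m s : List P) : List Λ :=
  labelWord lab (r ++ m.tail ++ s.tail) (r.length - 1) (m.length - 1)

/-- `lab` is a CL-labeling (chain lexicographic labeling) of the bounded poset `P` with values
in the poset `Λ`.

A chain-edge labeling attaches a label `lab c i` to each edge `c_i ⋖ c_{i+1}` of each maximal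
chain `c`, such that two maximal chains which coincide along their first `d` edges have the
same labels along these edges (`compat`); so the word of a chain `m` of a rooted interval
`[x, y]_r` does not depend on the chain `s` from `y` to `1̂` that completes `r ∪ m`.
It is a CL-labeling if every rooted interval `[x, y]_r` has a unique maximal chain whose word
is (weakly) increasing, and the word of this chain lexicographically strictly precedes the words
of all other maximal chains of `[x, y]`. -/
structure IsCLLabeling {P Λ : Type*} [PartialOrder P] [PartialOrder Λ]
    (lab : List P → ℕ → Λ) : Prop where
  compat : ∀ c c' : List P, IsMaxChainIn c → IsMaxChainIn c' →
    ∀ d : ℕ, c.take (d + 1) = c'.take (d + 1) → ∀ i < d, lab c i = lab c' i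
  increasing : ∀ (a x y b : P) (r s : List P), IsBot a → IsTop b → x ≤ y →
    IsMaxChainOf a x r → IsMaxChainOf y b s →
    ∃ m : List P, IsMaxChainOf x y m ∧ (rootedWord lab r m s).IsChain (· ≤ ·) ∧
      ∀ m' : List P, IsMaxChainOf x y m' → m' ≠ m →
        ¬ (rootedWord lab r m' s).IsChain (· ≤ ·) ∧
        List.Lex (· < ·) (rootedWord lab r m s) (rootedWord lab r m' s)

/-- A graded poset is CL-shellable if it admits a CL-labeling, with labels in some poset. -/
structure IsCLShellable (P : Type*) [PartialOrder P] : Prop extends IsGraded P where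
  exists_labeling : ∃ (Λ : Type) (_ : PartialOrder Λ) (lab : List P → ℕ → Λ), IsCLLabeling lab

/-! ### Reduced homology of the order complex and the Cohen–Macaulay property -/

/-- The free `R`-module on the chains `x₀ < ⋯ < x_{k-1}` with `k` elements of the poset `Q`,
that is, on the `(k-1)`-dimensional faces of the order complex of `Q`. The empty chain, `k = 0`,
is the face of dimension `-1`. -/
abbrev OrderChains (R : Type*) [CommRing R] (Q : Type*) [PartialOrder Q] (k : ℕ) : Type _ :=
  (Fin k ↪o Q) →₀ R

/-- The simplicial boundary `∂(x₀ < ⋯ < x_k) = ∑ᵢ (-1)ⁱ (x₀ < ⋯ < x̂ᵢ < ⋯ < x_k)`; for `k = 0`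
it is the augmentation. -/
noncomputable def orderBoundary (R : Type*) [CommRing R] (Q : Type*) [PartialOrder Q] (k : ℕ) :
    OrderChains R Q (k + 1) →ₗ[R] OrderChains R Q k :=
  Finsupp.linearCombination R fun f : Fin (k + 1) ↪o Q =>
    ∑ i : Fin (k + 1), Finsupp.single ((Fin.succAboveOrderEmb i).trans f) ((-1 : R) ^ (i : ℕ))

theorem orderBoundary_comp (R : Type*) [CommRing R] (Q : Type*) [PartialOrder Q] (k : ℕ) :
    orderBoundary R Q k ∘ₗ orderBoundary R Q (k + 1) = 0 := by
  ext f : 2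
  simp only [orderBoundary, LinearMap.comp_apply, Finsupp.lsingle_apply,
    Finsupp.linearCombination_single, one_smul, map_sum, LinearMap.zero_apply, Finset.smul_sum,
    Finsupp.smul_single, smul_eq_mul]
  rw [← Fintype.sum_prod_type']
  refine Finset.sum_involution (fun p _ => (p.1.succAbove p.2, p.2.predAbove p.1)) ?_ ?_ ?_ ?_
  · rintro ⟨i, j⟩ -
    have h : (Fin.succAboveOrderEmb (j.predAbove i)).trans
        ((Fin.succAboveOrderEmb (i.succAbove j)).trans f) =
        (Fin.succAboveOrderEmb j).trans ((Fin.succAboveOrderEmb i).trans f) := by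
      ext x
      simp [Fin.succAbove_succAbove_succAbove_predAbove]
    dsimp only
    rw [h, ← Finsupp.single_add, ← pow_add, ← pow_add,
      Fin.neg_one_pow_succAbove_add_predAbove, add_neg_cancel, Finsupp.single_zero]
  · rintro ⟨i, j⟩ - - h
    exact Fin.succAbove_ne i j (congrArg Prod.fst h)
  · intros
    simp
  · rintro ⟨i, j⟩ -
    simp [Fin.succAbove_succAbove_predAbove, Fin.predAbove_predAbove_succAbove]

/-- The cycles spanned by chains with `k` elements; all of the module when `k = 0`. -/
noncomputable def orderCycles (R : Type*) [CommRing R] (Q : Type*) [PartialOrder Q] :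
    (k : ℕ) → Submodule R (OrderChains R Q k)
  | 0 => ⊤
  | k + 1 => LinearMap.ker (orderBoundary R Q k)

/-- The quotient `Z / B` of a submodule `Z` by a submodule `B ⊆ Z`. -/
abbrev CyclesModBoundaries {R M : Type*} [CommRing R] [AddCommGroup M] [Module R M]
    (Z B : Submodule R M) : Type _ :=
  Z ⧸ B.submoduleOf Z

/-- The reduced simplicial homology `H̃_{k-1}(Δ(Q); R)` of the order complex of the poset `Q`,
with degree shifted by one: cycles spanned by chains with `k` elements modulo boundaries. -/
abbrev ReducedOrderHomology (R : Type*) [CommRing R] (Q : Type*) [PartialOrder Q] (k : ℕ) :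
    Type _ :=
  CyclesModBoundaries (orderCycles R Q k) (LinearMap.range (orderBoundary R Q k))

/-- The boundaries are cycles, so the quotient above is by all boundaries. -/
theorem range_orderBoundary_le_orderCycles (R : Type*) [CommRing R] (Q : Type*) [PartialOrder Q]
    (k : ℕ) : LinearMap.range (orderBoundary R Q k) ≤ orderCycles R Q k := by
  cases k with
  | zero => exact le_top
  | succ k => exact LinearMap.range_le_ker_iff.mpr (orderBoundary_comp R Q k)

/-- A graded poset is Cohen–Macaulay over `R` if for every open interval `(x, y)` the reduced
homology `H̃_i(Δ((x, y)); R)` vanishes for `i < dim Δ((x, y))`. With `i = k - 1` and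
`dim Δ(Q) = Order.krullDim Q` for nonempty `Q` the inequality reads `k ≤ Order.krullDim Q`;
for an empty `Q`, of dimension `-1`, there is no condition. -/
structure IsCohenMacaulay (R : Type*) [CommRing R] (P : Type*) [PartialOrder P] : Prop
    extends IsGraded P where
  vanishing : ∀ x y : P, x < y → ∀ k : ℕ,
    (k : WithBot ℕ∞) ≤ Order.krullDim (Set.Ioo x y) →
      Subsingleton (ReducedOrderHomology R (Set.Ioo x y) k)

/-! ### Pointed partitions -/

/-- A pointed partition of an `n`-element set: a partition (encoded by its equivalence
relation, whose classes are the blocks) together with the choice of one pointed element in each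
block (encoded by the set of pointed elements, which meets each block in exactly one element). -/
@[ext]
structure PointedPartition (n : ℕ) where
  partition : Setoid (Fin n)
  pointed : Set (Fin n)
  existsUnique_pointed : ∀ B ∈ partition.classes, ∃! p : Fin n, p ∈ B ∧ p ∈ pointed

/-- `π ≤ ν` if the partition of `π` refines that of `ν` and the pointed elements of `ν` are
pointed in `π`. -/
instance PointedPartition.instPartialOrder (n : ℕ) : PartialOrder (PointedPartition n) where
  le π ν := π.partition ≤ ν.partition ∧ ν.pointed ⊆ π.pointed
  le_refl π := ⟨le_refl _, subset_rfl⟩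
  le_trans _ _ _ h h' := ⟨h.1.trans h'.1, h'.2.trans h.2⟩
  le_antisymm _ _ h h' :=
    PointedPartition.ext (le_antisymm h.1 h'.1) (Set.Subset.antisymm h'.2 h.2)

/-- The least pointed partition: all blocks are singletons. -/
instance PointedPartition.instOrderBot (n : ℕ) : OrderBot (PointedPartition n) where
  bot :=
    { partition := ⊥
      pointed := Set.univ
      existsUnique_pointed := by
        rintro B ⟨y, rfl⟩
        exact ⟨y, ⟨rfl, trivial⟩, fun z hz => hz.1⟩ }
  bot_le π := ⟨bot_le, Set.subset_univ _⟩

/-! ### Maximal chains -/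

/-! Everything rests on one local property, `HasJoinCovers`: two elements covering `t` and lying
below `y` have a common cover below `y`. It passes to closed intervals and, for a finite bounded
poset, amounts to total semimodularity. Keeping the bound `y` in the statement lets one work in a
single ambient poset.

For pointed partitions (`PointedPartition.hasJoinCovers`), a cover merges two blocks and forgets one
of their pointed elements, so the number of pointed elements drops by one. Given two such merges
below `y`, one further merge compatible with `y` dominates both, and counting pointed elements shows
that it covers both. The bound is essential: merging two blocks with opposite choices of the pointed
element requires a third block, which `y` supplies.

The other two conclusions hold for every totally semimodular poset. Purity is the Jordan–Dedekind
argument. For CL-shellability, labels realise a recursive atom ordering: after `w ⋖ x`, the covers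
of `x` that also lie above an earlier cover of `w` come first, with labels below that of `w ⋖ x`.
The greedy chain of smallest labels is then the only increasing one, and it is lexicographically
first. For the Cohen–Macaulay property, `(x, y)` is a union of cones `[a, y)` over the atoms `a` of
`[x, y]`. Adding one cone at a time, Mayer–Vietoris reduces the vanishing to an intersection of the
same shape in `[a, y]`, one degree lower. This works over every commutative ring. -/

theorem IsMaxChainOf.singleton {P : Type*} [PartialOrder P] (x : P) : IsMaxChainOf x x [x] :=
  ⟨rfl, rfl, .singleton x⟩

theorem isMaxChainOf_cons {P : Type*} [PartialOrder P] {x y a : P} {c : List P} :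
    IsMaxChainOf x y (a :: c) ↔
      a = x ∧ ((c = [] ∧ x = y) ∨ ∃ b, x ⋖ b ∧ IsMaxChainOf b y c) := by
  constructor
  · rintro ⟨h1, h2, h3⟩
    obtain rfl : a = x := by simpa using h1
    refine ⟨rfl, ?_⟩
    cases c with
    | nil => exact .inl ⟨rfl, by simpa using h2⟩
    | cons b c =>
      rw [List.isChain_cons_cons] at h3
      exact .inr ⟨b, h3.1, rfl, by simpa using h2, h3.2⟩
  · rintro ⟨rfl, ⟨rfl, rfl⟩ | ⟨b, hb, h1, h2, h3⟩⟩
    · exact .singleton a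
    · cases c with
      | nil => simp at h1
      | cons b' c =>
        obtain rfl : b' = b := by simpa using h1
        exact ⟨rfl, by simpa using h2, List.isChain_cons_cons.2 ⟨hb, h3⟩⟩

theorem IsMaxChainOf.cons {P : Type*} [PartialOrder P] {x b y : P} {c : List P}
    (hb : x ⋖ b) (h : IsMaxChainOf b y c) : IsMaxChainOf x y (x :: c) :=
  isMaxChainOf_cons.2 ⟨rfl, .inr ⟨b, hb, h⟩⟩

theorem IsMaxChainOf.exists_eq_cons {P : Type*} [PartialOrder P] {x y : P} {c : List P}
    (h : IsMaxChainOf x y c) : ∃ c', c = x :: c' := by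
  cases c with
  | nil => simpa using h.head_eq
  | cons a c => exact ⟨c, by rw [(isMaxChainOf_cons.1 h).1]⟩

theorem IsMaxChainOf.le {P : Type*} [PartialOrder P] {x y : P} {c : List P}
    (h : IsMaxChainOf x y c) : x ≤ y := by
  induction c generalizing x with
  | nil => simpa using h.head_eq
  | cons a c ih =>
    obtain ⟨-, ⟨-, rfl⟩ | ⟨b, hb, h⟩⟩ := isMaxChainOf_cons.1 h
    · exact le_rfl
    · exact hb.le.trans (ih h)

theorem IsMaxChainOf.eq_singleton {P : Type*} [PartialOrder P] {x : P} {c : List P}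
    (h : IsMaxChainOf x x c) : c = [x] := by
  obtain ⟨c, rfl⟩ := h.exists_eq_cons
  obtain ⟨-, ⟨rfl, -⟩ | ⟨b, hb, h⟩⟩ := isMaxChainOf_cons.1 h
  · rfl
  · exact absurd h.le hb.lt.not_ge

theorem IsMaxChainOf.exists_of_ne {P : Type*} [PartialOrder P] {x y : P} {c : List P}
    (h : IsMaxChainOf x y c) (hxy : x ≠ y) :
    ∃ b c', c = x :: b :: c' ∧ x ⋖ b ∧ IsMaxChainOf b y (b :: c') := by
  obtain ⟨c, rfl⟩ := h.exists_eq_cons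
  obtain ⟨-, ⟨-, e⟩ | ⟨b, hb, h⟩⟩ := isMaxChainOf_cons.1 h
  · exact absurd e hxy
  · obtain ⟨c, rfl⟩ := h.exists_eq_cons
    exact ⟨b, c, rfl, hb, h⟩

theorem IsMaxChainOf.trans {P : Type*} [PartialOrder P] {x y z : P} {c d : List P}
    (h : IsMaxChainOf x y c) (h' : IsMaxChainOf y z d) : IsMaxChainOf x z (c ++ d.tail) := by
  induction c generalizing x with
  | nil => simpa using h.head_eq
  | cons a c ih =>
    obtain ⟨rfl, ⟨rfl, rfl⟩ | ⟨b, hb, h⟩⟩ := isMaxChainOf_cons.1 h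
    · obtain ⟨d, rfl⟩ := h'.exists_eq_cons
      simpa using h'
    · exact .cons hb (ih h)

theorem exists_covBy_le {P : Type*} [PartialOrder P] [Finite P] {x y : P} (h : x < y) :
    ∃ b, x ⋖ b ∧ b ≤ y := by
  obtain ⟨b, hb⟩ := (Set.toFinite {b | x < b ∧ b ≤ y}).exists_minimal ⟨y, h, le_rfl⟩
  refine ⟨b, ⟨hb.prop.1, fun c hc hcb => ?_⟩, hb.prop.2⟩
  exact hcb.not_ge (hb.le_of_le ⟨hc, hcb.le.trans hb.prop.2⟩ hcb.le)

theorem exists_isMaxChainOf {P : Type*} [PartialOrder P] [Finite P] {x y : P} (h : x ≤ y) :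
    ∃ c, IsMaxChainOf x y c := by
  induction x using WellFoundedGT.induction with
  | ind x ih =>
    obtain rfl | h := h.eq_or_lt
    · exact ⟨_, .singleton x⟩
    · obtain ⟨b, hb, hby⟩ := exists_covBy_le h
      obtain ⟨c, hc⟩ := ih b hb.lt hby
      exact ⟨_, .cons hb hc⟩

/-! ### The covering property of totally semimodular posets -/

theorem covBy_coe_Icc {P : Type*} [PartialOrder P] {x y : P} {a b : Set.Icc x y} :
    (a : P) ⋖ b ↔ a ⋖ b :=
  Set.OrdConnected.apply_covBy_apply_iff (OrderEmbedding.subtype fun p => p ∈ Set.Icc x y)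
    (Subtype.range_coe_subtype (p := fun p => p ∈ Set.Icc x y) ▸ Set.ordConnected_Icc)

/-- Two elements that cover a common element and are below `y` are covered by a common element
below `y`. -/
def HasJoinCovers (P : Type*) [PartialOrder P] : Prop :=
  ∀ t u v y : P, u ≠ v → t ⋖ u → t ⋖ v → u ≤ y → v ≤ y → ∃ z ≤ y, u ⋖ z ∧ v ⋖ z

theorem HasJoinCovers.Icc {P : Type*} [PartialOrder P] (h : HasJoinCovers P) (x y : P) :
    HasJoinCovers (Set.Icc x y) := by
  intro t u v w huv hu hv huw hvw
  obtain ⟨z, hz, huz, hvz⟩ := h t u v w (Subtype.coe_injective.ne huv) (covBy_coe_Icc.2 hu)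
    (covBy_coe_Icc.2 hv) huw hvw
  exact ⟨⟨z, u.2.1.trans huz.le, hz.trans w.2.2⟩, hz, covBy_coe_Icc.1 huz, covBy_coe_Icc.1 hvz⟩

theorem isFiniteBounded_Icc {P : Type*} [PartialOrder P] [Finite P] {x y : P} (h : x ≤ y) :
    IsFiniteBounded (Set.Icc x y) :=
  ⟨inferInstance, ⟨⟨x, le_rfl, h⟩, fun b => b.2.1⟩, ⟨⟨y, h, le_rfl⟩, fun b => b.2.2⟩⟩

theorem HasJoinCovers.isSemimodular_Icc {P : Type*} [PartialOrder P] [Finite P]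
    (h : HasJoinCovers P) {x y : P} (hxy : x ≤ y) : IsSemimodular (Set.Icc x y) where
  toIsFiniteBounded := isFiniteBounded_Icc hxy
  exists_cover t u v huv hu hv := by
    obtain ⟨z, -, hz⟩ := h.Icc x y t u v ⟨y, hxy, le_rfl⟩ huv hu hv u.2.2 v.2.2
    exact ⟨z, hz⟩

theorem HasJoinCovers.isTotallySemimodular {P : Type*} [PartialOrder P]
    (h : HasJoinCovers P) (hP : IsFiniteBounded P) : IsTotallySemimodular P where
  toIsFiniteBounded := hP
  interval _ _ hxy := haveI := hP.finite; h.isSemimodular_Icc hxy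

theorem IsTotallySemimodular.hasJoinCovers {P : Type*} [PartialOrder P]
    (h : IsTotallySemimodular P) : HasJoinCovers P := by
  intro t u v y huv hu hv huy hvy
  have hty := hu.le.trans huy
  obtain ⟨z, huz, hvz⟩ := (h.interval t y hty).exists_cover ⟨t, le_rfl, hty⟩ ⟨u, hu.le, huy⟩
    ⟨v, hv.le, hvy⟩ (fun e => huv (congrArg Subtype.val e)) (covBy_coe_Icc.1 hu) (covBy_coe_Icc.1 hv)
  exact ⟨z, z.2.2, covBy_coe_Icc.2 huz, covBy_coe_Icc.2 hvz⟩

/-- If the chains start with different covers `u` and `v` of `x`, both are compared with chains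
through a common cover `z ≤ y` that share their part from `z` to `y`. -/
theorem HasJoinCovers.length_eq {P : Type*} [PartialOrder P] [Finite P] (h : HasJoinCovers P)
    {x y : P} {c c' : List P} (hc : IsMaxChainOf x y c) (hc' : IsMaxChainOf x y c') :
    c.length = c'.length := by
  induction hl : c.length generalizing x c c' with
  | zero =>
    obtain ⟨c, rfl⟩ := hc.exists_eq_cons
    simp at hl
  | succ l ih =>
    by_cases hxy : x = y
    · subst hxy
      rw [← hl, hc.eq_singleton, hc'.eq_singleton]
    · obtain ⟨u, c, rfl, hu, hc⟩ := hc.exists_of_ne hxy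
      obtain ⟨v, c', rfl, hv, hc'⟩ := hc'.exists_of_ne hxy
      rw [List.length_cons] at hl ⊢
      have hl := Nat.succ.inj hl
      congr 1
      by_cases huv : u = v
      · subst huv
        exact ih hc hc' hl
      · obtain ⟨z, hz, huz, hvz⟩ := h x u v y huv hu hv hc.le hc'.le
        obtain ⟨d, hd⟩ := exists_isMaxChainOf hz
        have hlen := ih hc (.cons huz hd) hl
        exact ih (.cons hvz hd) hc' (by rw [List.length_cons] at hlen ⊢; exact hlen.symm)

theorem IsTotallySemimodular.isGraded {P : Type*} [PartialOrder P]
    (h : IsTotallySemimodular P) : IsGraded P where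
  toIsFiniteBounded := h.toIsFiniteBounded
  pure _ _ _ _ hc hc' := haveI := h.finite; h.hasJoinCovers.length_eq hc hc'

/-! ### The CL-labeling of a totally semimodular poset -/

open Classical in
/-- The label of the edge from the first element of `r` to `y`, where `r` is a saturated chain
from the least element, in decreasing order. The label is smaller than that of the preceding edge
`w ⋖ x` if and only if `y` covers some `x' ⋗ w` for which the edge `w ⋖ x'` has a smaller label
than `w ⋖ x`. Here `e` is an enumeration of `P` with values in `[0, N)`. -/
noncomputable def chainLabel {P : Type*} [PartialOrder P] (e : P → ℤ) (N : ℤ) : List P → P → ℤ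
  | [], y => e y
  | [_], y => e y
  | x :: w :: r, y => chainLabel e N (w :: r) x + e y -
      if ∃ x', w ⋖ x' ∧ x' ⋖ y ∧ chainLabel e N (w :: r) x' < chainLabel e N (w :: r) x
      then N else 0

/-- Since `0 ≤ e y < N`, subtracting `N` or not decides the sign of the difference from the
preceding label. -/
theorem chainLabel_lt_iff {P : Type*} [PartialOrder P] {e : P → ℤ} {N : ℤ}
    (he : ∀ p, 0 ≤ e p ∧ e p < N) {x w y : P} {r : List P} :
    chainLabel e N (x :: w :: r) y < chainLabel e N (w :: r) x ↔
      ∃ x', w ⋖ x' ∧ x' ⋖ y ∧ chainLabel e N (w :: r) x' < chainLabel e N (w :: r) x := by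
  have := he y
  rw [chainLabel]
  split_ifs with h
  · exact iff_of_true (by omega) h
  · exact iff_of_false (by omega) h

/-- The corrections `e y` lie in `[0, N)` and the corrections `e y - N` in `[-N, 0)`, so the two
kinds never collide. -/
theorem chainLabel_injective {P : Type*} [PartialOrder P] {e : P → ℤ} {N : ℤ}
    (he : ∀ p, 0 ≤ e p ∧ e p < N) (hinj : Function.Injective e) (r : List P) :
    Function.Injective (chainLabel e N r) := by
  intro y z h
  have hy := he y
  have hz := he z
  match r with
  | [] => exact hinj h
  | [_] => exact hinj h
  | x :: w :: r =>
    rw [chainLabel, chainLabel] at h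
    apply hinj
    split_ifs at h <;> omega

/-- The labels along `m`, a chain that continues the chain `r` (in decreasing order). -/
noncomputable def chainWord {P : Type*} [PartialOrder P] (e : P → ℤ) (N : ℤ) :
    List P → List P → List ℤ
  | _, [] => []
  | r, y :: m => chainLabel e N r y :: chainWord e N (y :: r) m

/-- The labeling of maximal chains whose labels are given by `chainLabel`. -/
noncomputable def chainLabeling {P : Type*} [PartialOrder P] (e : P → ℤ) (N : ℤ)
    (m : List P) (i : ℕ) : ℤ :=
  m[i + 1]?.elim 0 (chainLabel e N (m.take (i + 1)).reverse)

theorem labelWord_chainLabeling {P : Type*} [PartialOrder P] (e : P → ℤ) (N : ℤ)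
    (r m s : List P) (hr : r ≠ []) :
    labelWord (chainLabeling e N) (r ++ m ++ s) (r.length - 1) m.length =
      chainWord e N r.reverse m := by
  induction m generalizing r with
  | nil => simp [labelWord, chainWord]
  | cons y m ih =>
    have hpos : r.length - 1 + 1 = r.length := Nat.sub_add_cancel (List.length_pos_of_ne_nil hr)
    have h := ih (r ++ [y]) (by simp)
    simp only [labelWord, List.length_append, List.length_singleton, List.append_assoc,
      List.singleton_append, List.reverse_append, List.reverse_singleton,
      Nat.add_sub_cancel] at h
    rw [labelWord, List.length_cons, List.range_succ_eq_map, List.map_cons, chainWord,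
      List.map_map, ← h]
    congr 1
    · simp [chainLabeling, hpos]
    · refine List.map_congr_left fun i _ => ?_
      have : r.length - 1 + (i + 1) = r.length + i := by omega
      simp [this]

/-- An increasing chain must start with the smallest label available below `y`, which gives
uniqueness. If `a` had a smaller label than `b`, a common cover `z ≤ y` would receive a label after
`b` below that of `b`. By induction the next label of the chain is at most that of `z`, hence a
descent. -/
theorem chainLabel_le_of_isChain {P : Type*} [PartialOrder P] (h : HasJoinCovers P)
    {e : P → ℤ} {N : ℤ} (he : ∀ p, 0 ≤ e p ∧ e p < N) {x y b : P} {r m : List P}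
    (hxb : x ⋖ b) (hm : IsMaxChainOf b y (b :: m))
    (hinc : (chainWord e N (x :: r) (b :: m)).IsChain (· ≤ ·)) {a : P} (ha : x ⋖ a)
    (hay : a ≤ y) : chainLabel e N (x :: r) b ≤ chainLabel e N (x :: r) a := by
  induction m generalizing x b r a with
  | nil =>
    obtain ⟨-, ⟨-, rfl⟩ | ⟨c, -, hc⟩⟩ := isMaxChainOf_cons.1 hm
    · obtain h | h := hay.eq_or_lt
      · rw [h]
      · exact absurd h (hxb.2 ha.lt)
    · simpa using hc.head_eq
  | cons c m ih =>
    obtain ⟨-, ⟨h, -⟩ | ⟨c', hbc, hc⟩⟩ := isMaxChainOf_cons.1 hm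
    · simp at h
    obtain rfl : c = c' := by simpa using hc.head_eq
    by_contra! hlt
    obtain ⟨z, hzy, hbz, haz⟩ := h x b a y (by rintro rfl; exact lt_irrefl _ hlt) hxb ha hm.le hay
    rw [chainWord, chainWord, List.isChain_cons_cons] at hinc
    have h1 := ih hbc hc hinc.2 hbz hzy
    have h2 := (chainLabel_lt_iff he (r := r)).2 ⟨a, ha, haz, hlt⟩
    exact (h1.trans_lt h2).not_ge hinc.1

/-- The chain is built greedily: each step takes the cover below `y` with the smallest label. -/
theorem exists_increasing_chain {P : Type*} [PartialOrder P] [Finite P] (h : HasJoinCovers P)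
    {e : P → ℤ} {N : ℤ} (he : ∀ p, 0 ≤ e p ∧ e p < N) (hinj : Function.Injective e)
    {x y : P} (hxy : x ≤ y) (r : List P) :
    ∃ m : List P, IsMaxChainOf x y (x :: m) ∧ (chainWord e N (x :: r) m).IsChain (· ≤ ·) ∧
      ∀ m' : List P, IsMaxChainOf x y (x :: m') → m' ≠ m →
        ¬ (chainWord e N (x :: r) m').IsChain (· ≤ ·) ∧
        List.Lex (· < ·) (chainWord e N (x :: r) m) (chainWord e N (x :: r) m') := by
  induction x using WellFoundedGT.induction generalizing r with
  | ind x ih =>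
    obtain rfl | hlt := hxy.eq_or_lt
    · refine ⟨[], .singleton x, .nil, fun m' hm' hne => absurd ?_ hne⟩
      simpa using hm'.eq_singleton
    · obtain ⟨b, ⟨hb, hby⟩, hmin⟩ := Set.exists_min_image {b | x ⋖ b ∧ b ≤ y}
        (chainLabel e N (x :: r)) (Set.toFinite _) (exists_covBy_le hlt)
      obtain ⟨m, hm, hinc, huniq⟩ := ih b hb.lt hby (x :: r)
      refine ⟨b :: m, .cons hb hm, ?_, fun m' hm' hne => ?_⟩
      · cases m with
        | nil => exact .singleton _
        | cons c m =>
          refine List.isChain_cons_cons.2 ⟨?_, hinc⟩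
          -- A descent at `c` would exhibit a cover `a ≤ y` of `x` with a smaller label than the
          -- minimal `b`.
          by_contra! hc
          obtain ⟨a, ha, hac, hlt⟩ := (chainLabel_lt_iff he).1 hc
          obtain ⟨-, ⟨h, -⟩ | ⟨c', -, hc'⟩⟩ := isMaxChainOf_cons.1 hm
          · simp at h
          obtain rfl : c = c' := by simpa using hc'.head_eq
          exact (hmin a ⟨ha, hac.le.trans hc'.le⟩).not_gt hlt
      · obtain ⟨b', m'', heq, hb', hm''⟩ := hm'.exists_of_ne hlt.ne
        obtain rfl : m' = b' :: m'' := by simpa using heq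
        by_cases hbb : b' = b
        · subst hbb
          obtain ⟨h1, h2⟩ := huniq m'' hm'' (by rintro rfl; exact hne rfl)
          exact ⟨fun h => h1 h.tail, .cons h2⟩
        · have hlt' : chainLabel e N (x :: r) b < chainLabel e N (x :: r) b' :=
            (hmin b' ⟨hb', hm''.le⟩).lt_of_ne
              fun h => hbb (chainLabel_injective he hinj _ h).symm
          exact ⟨fun hch => (chainLabel_le_of_isChain h he hb' hm'' hch hb hby).not_gt hlt',
            .rel hlt'⟩

theorem isCLLabeling_chainLabeling {P : Type*} [PartialOrder P] [Finite P]
    (h : HasJoinCovers P) {e : P → ℤ} {N : ℤ} (he : ∀ p, 0 ≤ e p ∧ e p < N)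
    (hinj : Function.Injective e) : IsCLLabeling (chainLabeling e N) where
  compat m m' _ _ d hd i hi := by
    have h1 : m.take (i + 1) = m'.take (i + 1) := by
      have := congrArg (List.take (i + 1)) hd
      simpa [List.take_take, Nat.min_eq_left (show i + 1 ≤ d + 1 by omega)] using this
    have h2 : m[i + 1]? = m'[i + 1]? := by
      have := congrArg (fun l : List P => l[i + 1]?) hd
      simpa [List.getElem?_take, hi] using this
    rw [chainLabeling, chainLabeling, h1, h2]
  increasing a x y b r s _ _ hxy hr _ := by
    obtain ⟨ρ, hρ⟩ : ∃ ρ, r.reverse = x :: ρ := by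
      have := hr.last_eq
      rw [← List.head?_reverse] at this
      cases hrev : r.reverse with
      | nil => simp [hrev] at this
      | cons z ρ => exact ⟨ρ, by simpa [hrev] using this⟩
    have hne : r ≠ [] := by rintro rfl; simp at hρ
    have hword (m : List P) :
        rootedWord (chainLabeling e N) r (x :: m) s = chainWord e N (x :: ρ) m := by
      rw [← hρ, ← labelWord_chainLabeling e N r m s.tail hne]
      rfl
    obtain ⟨m, hm, hinc, huniq⟩ := exists_increasing_chain h he hinj hxy ρ
    refine ⟨x :: m, hm, by rwa [hword], fun m' hm' hmm => ?_⟩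
    obtain ⟨m', rfl⟩ := hm'.exists_eq_cons
    rw [hword, hword]
    exact huniq m' hm' fun h => hmm (by rw [h])

theorem IsTotallySemimodular.isCLShellable {P : Type*} [PartialOrder P]
    (h : IsTotallySemimodular P) : IsCLShellable P where
  toIsGraded := h.isGraded
  exists_labeling := by
    have := h.finite
    obtain ⟨N, ⟨f⟩⟩ := Finite.exists_equiv_fin P
    refine ⟨ℤ, inferInstance, chainLabeling (fun p => (f p : ℤ)) N,
      isCLLabeling_chainLabeling h.hasJoinCovers (fun p => ⟨by positivity, by simp⟩) ?_⟩
    intro p q hpq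
    exact f.injective (Fin.ext (by simpa using hpq))

/-! ### Chains supported in a subset of a poset -/

/-- The span of the chains with `k` elements, all of which lie in `A`. -/
def chainsIn (R : Type*) [CommRing R] {P : Type*} [PartialOrder P] (A : Set P) (k : ℕ) :
    Submodule R (OrderChains R P k) :=
  Finsupp.supported R R {f | ∀ i, f i ∈ A}

/-- The reduced homology of the order complex of the subposet `A` vanishes in degree `k - 1`. -/
def IsAcyclicIn (R : Type*) [CommRing R] {P : Type*} [PartialOrder P] (A : Set P) (k : ℕ) :
    Prop :=
  ∀ z ∈ chainsIn R A k, z ∈ orderCycles R P k →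
    ∃ w ∈ chainsIn R A (k + 1), orderBoundary R P k w = z

section

variable {R : Type*} [CommRing R] {P : Type*} [PartialOrder P]

theorem orderBoundary_single {k : ℕ} (f : Fin (k + 1) ↪o P) (r : R) :
    orderBoundary R P k (Finsupp.single f r) =
      r • ∑ i : Fin (k + 1),
        Finsupp.single ((Fin.succAboveOrderEmb i).trans f) ((-1 : R) ^ (i : ℕ)) := by
  rw [orderBoundary, Finsupp.linearCombination_single]

theorem chainsIn_mono {A B : Set P} (h : A ⊆ B) (k : ℕ) : chainsIn R A k ≤ chainsIn R B k :=
  Finsupp.supported_mono fun _ hf i => h (hf i)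

theorem mem_chainsIn_inter {A B : Set P} {k : ℕ} {z : OrderChains R P k}
    (hA : z ∈ chainsIn R A k) (hB : z ∈ chainsIn R B k) : z ∈ chainsIn R (A ∩ B) k :=
  fun _ hf i => ⟨hA hf i, hB hf i⟩

theorem orderBoundary_mem_chainsIn {A : Set P} {k : ℕ} {w : OrderChains R P (k + 1)}
    (hw : w ∈ chainsIn R A (k + 1)) : orderBoundary R P k w ∈ chainsIn R A k := by
  rw [orderBoundary, Finsupp.linearCombination_apply]
  refine Submodule.sum_mem _ fun f hf => Submodule.smul_mem _ _ (Submodule.sum_mem _ fun i _ => ?_)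
  exact Finsupp.single_mem_supported _ _ fun j => hw hf _

theorem isAcyclicIn_zero {A : Set P} (hA : A.Nonempty) : IsAcyclicIn R A 0 := by
  intro z _ _
  obtain ⟨a, ha⟩ := hA
  let f : Fin 1 ↪o P := OrderEmbedding.ofStrictMono (fun _ => a) (Subsingleton.strictMono _)
  have hsub (g g' : Fin 0 ↪o P) : g = g' := by
    ext i
    exact i.elim0
  refine ⟨Finsupp.single f (z ((Fin.succAboveOrderEmb 0).trans f)),
    Finsupp.single_mem_supported _ _ fun _ => ha, ?_⟩
  rw [orderBoundary_single]
  ext g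
  rw [hsub g ((Fin.succAboveOrderEmb 0).trans f)]
  simp

/-- The Mayer–Vietoris argument. -/
theorem IsAcyclicIn.union {A B : Set P} {k : ℕ}
    (hAB : ∀ f : Fin (k + 1) ↪o P, (∀ i, f i ∈ A ∪ B) → (∀ i, f i ∈ A) ∨ ∀ i, f i ∈ B)
    (hA : IsAcyclicIn R A (k + 1)) (hB : IsAcyclicIn R B (k + 1))
    (h : IsAcyclicIn R (A ∩ B) k) : IsAcyclicIn R (A ∪ B) (k + 1) := by
  classical
  intro z hz hcyc
  obtain ⟨z₁, z₂, h₁, h₂, rfl⟩ : ∃ z₁ z₂, z₁ ∈ chainsIn R A (k + 1) ∧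
      z₂ ∈ chainsIn R B (k + 1) ∧ z₁ + z₂ = z := by
    refine ⟨_, _, ?_, ?_, Finsupp.filter_add_filter_not z fun f => ∀ i, f i ∈ A⟩
    · intro f hf
      exact (Finset.mem_filter.1
        (Finsupp.support_filter z (p := fun f : Fin (k + 1) ↪o P => ∀ i, f i ∈ A) ▸ hf)).2
    · intro f hf
      have hf := Finset.mem_filter.1
        (Finsupp.support_filter z (p := fun f : Fin (k + 1) ↪o P => ¬ ∀ i, f i ∈ A) ▸ hf)
      exact (hAB f (hz hf.1)).resolve_left hf.2
  have hsum : orderBoundary R P k z₁ + orderBoundary R P k z₂ = 0 := by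
    rw [← map_add]; exact hcyc
  have hneg : orderBoundary R P k z₂ = -orderBoundary R P k z₁ :=
    (neg_eq_of_add_eq_zero_right hsum).symm
  -- The boundary of `z₂` is, up to sign, that of `z₁`, so it lives in `A ∩ B`; the chain `w`
  -- filling it there turns `z₁` and `z₂` into cycles.
  obtain ⟨w, hw, hwz⟩ := h (orderBoundary R P k z₂)
    (mem_chainsIn_inter (hneg ▸ Submodule.neg_mem _ (orderBoundary_mem_chainsIn h₁))
      (orderBoundary_mem_chainsIn h₂))
    (range_orderBoundary_le_orderCycles R P k ⟨_, rfl⟩)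
  obtain ⟨w₁, hw₁, e₁⟩ := hA (z₁ + w)
    (Submodule.add_mem _ h₁ (chainsIn_mono Set.inter_subset_left _ hw))
    (show orderBoundary R P k (z₁ + w) = 0 by rw [map_add, hwz, hsum])
  obtain ⟨w₂, hw₂, e₂⟩ := hB (z₂ - w)
    (Submodule.sub_mem _ h₂ (chainsIn_mono Set.inter_subset_right _ hw))
    (show orderBoundary R P k (z₂ - w) = 0 by rw [map_sub, hwz, sub_self])
  refine ⟨w₁ + w₂, Submodule.add_mem _ (chainsIn_mono Set.subset_union_left _ hw₁)
    (chainsIn_mono Set.subset_union_right _ hw₂), ?_⟩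
  rw [map_add, e₁, e₂]
  abel

/-! ### Cones are acyclic -/

/-- The chain `a < f 0 < ⋯ < f (k - 1)`. -/
def consChain {k : ℕ} (a : P) (f : Fin k ↪o P) (h : ∀ i, a < f i) : Fin (k + 1) ↪o P :=
  OrderEmbedding.ofStrictMono (Fin.cons a f) <| by
    intro i j hij
    induction j using Fin.cases with
    | zero => exact absurd hij (Fin.not_lt_zero i)
    | succ j =>
      induction i using Fin.cases with
      | zero => simpa using h j
      | succ i => simpa using hij

@[simp] theorem consChain_zero {k : ℕ} (a : P) (f : Fin k ↪o P) (h : ∀ i, a < f i) :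
    consChain a f h 0 = a := rfl

@[simp] theorem consChain_succ {k : ℕ} (a : P) (f : Fin k ↪o P) (h : ∀ i, a < f i) (i : Fin k) :
    consChain a f h i.succ = f i := rfl

variable (R) in
open Classical in
/-- The linear map that prepends `a` to the chains above `a` and kills the other chains. -/
noncomputable def coneMap (a : P) (k : ℕ) : OrderChains R P k →ₗ[R] OrderChains R P (k + 1) :=
  Finsupp.linearCombination R fun f =>
    if h : ∀ i, a < f i then Finsupp.single (consChain a f h) 1 else 0

theorem coneMap_single_of_lt {a : P} {k : ℕ} {f : Fin k ↪o P} (h : ∀ i, a < f i) (r : R) :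
    coneMap R a k (Finsupp.single f r) = Finsupp.single (consChain a f h) r := by
  rw [coneMap, Finsupp.linearCombination_single, dif_pos h, Finsupp.smul_single, smul_eq_mul,
    mul_one]

theorem coneMap_single_of_eq {a : P} {k : ℕ} {f : Fin k ↪o P} {i : Fin k} (h : f i = a) (r : R) :
    coneMap R a k (Finsupp.single f r) = 0 := by
  rw [coneMap, Finsupp.linearCombination_single, dif_neg fun h' => (h' i).ne h.symm, smul_zero]

theorem coneMap_mem_chainsIn {A : Set P} {a : P} (ha : a ∈ A) {k : ℕ} {z : OrderChains R P k}
    (hz : z ∈ chainsIn R A k) : coneMap R a k z ∈ chainsIn R A (k + 1) := by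
  rw [coneMap, Finsupp.linearCombination_apply]
  refine Submodule.sum_mem _ fun f hf => Submodule.smul_mem _ _ ?_
  split_ifs with h
  · refine Finsupp.single_mem_supported _ _ fun i => ?_
    induction i using Fin.cases with
    | zero => exact ha
    | succ i => exact hz hf i
  · exact Submodule.zero_mem _

/-- Prepending `a` is a contracting homotopy. If `f` starts with `a`, only the face omitting `a`
survives; otherwise all faces of the cone containing `a` cancel against the second term. -/
theorem orderBoundary_coneMap_single {a : P} {k : ℕ} {f : Fin (k + 1) ↪o P} (hf : ∀ i, a ≤ f i) :
    orderBoundary R P (k + 1) (coneMap R a (k + 1) (Finsupp.single f 1)) +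
      coneMap R a k (orderBoundary R P k (Finsupp.single f 1)) = Finsupp.single f 1 := by
  rw [orderBoundary_single, one_smul, map_sum]
  obtain h0 | h0 := (hf 0).eq_or_lt
  · rw [coneMap_single_of_eq h0.symm, map_zero, zero_add, Fin.sum_univ_succ, Finset.sum_eq_zero]
    · have h (i : Fin k) : a < ((Fin.succAboveOrderEmb 0).trans f) i := by
        rw [h0]
        exact f.strictMono (by simp [Fin.pos_iff_ne_zero])
      rw [coneMap_single_of_lt h, add_zero, Fin.val_zero, pow_zero]
      congr 1
      ext i
      induction i using Fin.cases with
      | zero => simp [h0]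
      | succ i => simp
    · intro i _
      obtain ⟨k, rfl⟩ : ∃ l, k = l + 1 := ⟨k - 1, by have := i.2; omega⟩
      exact coneMap_single_of_eq (i := 0) (by simp [h0]) _
  · have h (i : Fin (k + 1)) : a < f i := h0.trans_le (f.monotone (Fin.zero_le i))
    have hface : (Fin.succAboveOrderEmb 0).trans (consChain a f h) = f := by
      ext i
      simp
    have hcone (i : Fin (k + 1)) : (Fin.succAboveOrderEmb i.succ).trans (consChain a f h) =
        consChain a ((Fin.succAboveOrderEmb i).trans f) (fun j => h _) := by
      ext j
      induction j using Fin.cases with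
      | zero => exact (congrArg (consChain a f h) (Fin.succ_succAbove_zero i)).trans rfl
      | succ j => exact (congrArg (consChain a f h) (Fin.succ_succAbove_succ i j)).trans rfl
    rw [coneMap_single_of_lt h, orderBoundary_single, one_smul, Fin.sum_univ_succ, hface,
      add_assoc, ← Finset.sum_add_distrib, Finset.sum_eq_zero, add_zero, Fin.val_zero, pow_zero]
    intro i _
    rw [coneMap_single_of_lt (f := (Fin.succAboveOrderEmb i).trans f) (fun j => h _), hcone,
      ← Finsupp.single_add, Fin.val_succ, pow_succ, mul_neg_one, neg_add_cancel, Finsupp.single_zero]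

theorem isAcyclicIn_of_isLeast {A : Set P} {a : P} (ha : IsLeast A a) (k : ℕ) :
    IsAcyclicIn R A k := by
  cases k with
  | zero => exact isAcyclicIn_zero ⟨a, ha.1⟩
  | succ k =>
    intro z hz hcyc
    refine ⟨_, coneMap_mem_chainsIn ha.1 hz, ?_⟩
    have key : Set.EqOn (orderBoundary R P (k + 1) ∘ₗ coneMap R a (k + 1) +
        coneMap R a k ∘ₗ orderBoundary R P k) (LinearMap.id (R := R))
        (chainsIn R A (k + 1) : Set (OrderChains R P (k + 1))) := by
      rw [chainsIn, Finsupp.supported_eq_span_single]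
      refine LinearMap.eqOn_span ?_
      rintro _ ⟨f, hf, rfl⟩
      exact orderBoundary_coneMap_single fun i => ha.2 (hf i)
    have hcyc : orderBoundary R P k z = 0 := hcyc
    simpa [hcyc] using key hz

/-! ### Passing to the subposet -/

/-- Chains of the subposet embed, compatibly with the boundary, onto the chains of `P` supported in
`A`. -/
theorem IsAcyclicIn.subsingleton_reducedOrderHomology {A : Set P} {k : ℕ}
    (h : IsAcyclicIn R A k) : Subsingleton (ReducedOrderHomology R A k) := by
  let ι (k : ℕ) (f : Fin k ↪o A) : Fin k ↪o P := f.trans (OrderEmbedding.subtype (· ∈ A))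
  have hι (k : ℕ) : Function.Injective (ι k) := fun f g hfg => by
    ext i
    exact congrArg (fun f : Fin k ↪o P => f i) hfg
  let φ (k : ℕ) : OrderChains R A k →ₗ[R] OrderChains R P k := Finsupp.lmapDomain R R (ι k)
  have hφ (k : ℕ) : Function.Injective (φ k) := Finsupp.mapDomain_injective (hι k)
  have hcomm (k : ℕ) (w : OrderChains R A (k + 1)) :
      φ k (orderBoundary R A k w) = orderBoundary R P k (φ (k + 1) w) := by
    suffices φ k ∘ₗ orderBoundary R A k = orderBoundary R P k ∘ₗ φ (k + 1) from
      LinearMap.congr_fun this w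
    refine Finsupp.lhom_ext fun f r => ?_
    simp only [LinearMap.comp_apply, orderBoundary_single, φ, map_smul, map_sum,
      Finsupp.lmapDomain_apply, Finsupp.mapDomain_single]
    rfl
  have hrange (k : ℕ) {w : OrderChains R P k} (hw : w ∈ chainsIn R A k) : ∃ v, φ k v = w := by
    rw [chainsIn, Finsupp.supported_eq_span_single] at hw
    refine Submodule.span_le (p := LinearMap.range (φ k)).2 ?_ hw
    rintro _ ⟨f, hf, rfl⟩
    refine ⟨Finsupp.single (OrderEmbedding.ofStrictMono (fun i => ⟨f i, hf i⟩)
      fun i j hij => f.strictMono hij) 1, ?_⟩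
    rw [Finsupp.lmapDomain_apply, Finsupp.mapDomain_single]
    rfl
  refine Submodule.Quotient.subsingleton_iff.2 (Submodule.submoduleOf_eq_top.2 ?_)
  intro z hz
  have hz' : φ k z ∈ orderCycles R P k := by
    cases k with
    | zero => exact Submodule.mem_top
    | succ k =>
      have hz : orderBoundary R A k z = 0 := hz
      change orderBoundary R P k (φ (k + 1) z) = 0
      rw [← hcomm, hz, map_zero]
  have hz'' : φ k z ∈ chainsIn R A k := by
    intro f hf i
    classical
    obtain ⟨g, -, rfl⟩ := Finset.mem_image.1 (Finsupp.mapDomain_support hf)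
    exact (g i).2
  obtain ⟨w, hw, hwz⟩ := h _ hz'' hz'
  obtain ⟨v, rfl⟩ := hrange _ hw
  exact ⟨v, hφ k (by rw [hcomm, hwz])⟩

end

/-! ### Totally semimodular posets are Cohen–Macaulay -/

/-- Allowing an arbitrary nonempty set `S` of atoms of `[x, y]` makes the double induction possible,
on the degree and on `S`. The bound `k + 3` says that the degree `k - 1` is below the dimension
`c.length - 3` of the open interval. -/
theorem HasJoinCovers.isAcyclicIn {P : Type*} [PartialOrder P] [Finite P]
    (h : HasJoinCovers P) (R : Type*) [CommRing R] {k : ℕ} {x y : P} {c : List P}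
    (hc : IsMaxChainOf x y c) (hk : k + 3 ≤ c.length) {S : Finset P} (hS : S.Nonempty)
    (hSx : ∀ a ∈ S, x ⋖ a ∧ a ≤ y) :
    IsAcyclicIn R {q | q < y ∧ ∃ a ∈ S, a ≤ q} k := by
  -- Otherwise `x ⋖ y`, and the maximal chains of `[x, y]` would have two elements instead of at
  -- least three.
  have hlt {a : P} (hxa : x ⋖ a) (hay : a ≤ y) : a < y := by
    refine hay.lt_of_ne ?_
    rintro rfl
    have := h.length_eq hc (.cons hxa (.singleton a))
    simp at this
    omega
  induction k generalizing x y c S with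
  | zero =>
    obtain ⟨a, ha⟩ := hS
    exact isAcyclicIn_zero ⟨a, hlt (hSx a ha).1 (hSx a ha).2, a, ha, le_rfl⟩
  | succ k ih =>
    classical
    induction hS using Finset.Nonempty.cons_induction with
    | singleton a =>
      have ha := hSx a (Finset.mem_singleton_self a)
      have hleast : IsLeast {q | q < y ∧ ∃ b ∈ ({a} : Finset P), b ≤ q} a :=
        And.intro ⟨hlt ha.1 ha.2, a, Finset.mem_singleton_self a, le_rfl⟩
          fun q ⟨_, b, hb, hbq⟩ => Finset.mem_singleton.1 hb ▸ hbq
      exact isAcyclicIn_of_isLeast hleast _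
    | cons a S haS hS ihS =>
      have ha := hSx a (Finset.mem_cons_self a S)
      have hSx' : ∀ b ∈ S, x ⋖ b ∧ b ≤ y := fun b hb => hSx b (Finset.mem_cons_of_mem hb)
      have hay := hlt ha.1 ha.2
      have hunion : {q | q < y ∧ ∃ b ∈ Finset.cons a S haS, b ≤ q} =
          {q | q < y ∧ ∃ b ∈ S, b ≤ q} ∪ Set.Ico a y := by
        ext q
        simp only [Finset.mem_cons, exists_eq_or_imp, Set.mem_ofPred_eq, Set.mem_union, Set.mem_Ico]
        rw [or_comm, and_or_left, and_comm (a := a ≤ q)]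
      -- The new cone meets the previous ones in the elements above some member of `T`, a set of
      -- atoms of `[a, y]`, by the common cover property.
      let T : Finset P := (Set.toFinite {z | a ⋖ z ∧ z ≤ y ∧ ∃ b ∈ S, b ⋖ z}).toFinset
      have hT {z : P} : z ∈ T ↔ a ⋖ z ∧ z ≤ y ∧ ∃ b ∈ S, b ⋖ z := Set.Finite.mem_toFinset _
      have hcov {b q : P} (hb : b ∈ S) (hbq : b ≤ q) (haq : a ≤ q) (hqy : q ≤ y) :
          ∃ z ∈ T, z ≤ q := by
        obtain ⟨z, hzq, haz, hbz⟩ := h x a b q (by rintro rfl; exact haS hb) ha.1 (hSx' b hb).1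
          haq hbq
        exact ⟨z, hT.2 ⟨haz, hzq.trans hqy, b, hb, hbz⟩, hzq⟩
      have hinter : {q | q < y ∧ ∃ b ∈ S, b ≤ q} ∩ Set.Ico a y =
          {q | q < y ∧ ∃ z ∈ T, z ≤ q} := by
        ext q
        constructor
        · rintro ⟨⟨hqy, b, hb, hbq⟩, haq, -⟩
          exact ⟨hqy, hcov hb hbq haq hqy.le⟩
        · rintro ⟨hqy, z, hz, hzq⟩
          obtain ⟨haz, -, b, hb, hbz⟩ := hT.1 hz
          exact ⟨⟨hqy, b, hb, hbz.le.trans hzq⟩, haz.le.trans hzq, hqy⟩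
      rw [hunion]
      refine IsAcyclicIn.union ?_ (ihS hSx')
        (isAcyclicIn_of_isLeast (isLeast_Ico hay) _) ?_
      -- Both sets are closed upwards below `y`, so the least element of a chain decides which one
      -- contains it.
      · intro f hf
        refine (hf 0).imp (fun h0 i => ?_) fun h0 i => ?_
        · obtain ⟨-, b, hb, hb0⟩ := h0
          exact ⟨(hf i).elim And.left And.right, b, hb, hb0.trans (f.monotone (Fin.zero_le i))⟩
        · exact ⟨h0.1.trans (f.monotone (Fin.zero_le i)), (hf i).elim And.left And.right⟩
      · rw [hinter]
        obtain ⟨d, hd⟩ := exists_isMaxChainOf ha.2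
        have hlen := h.length_eq hc (.cons ha.1 hd)
        rw [List.length_cons] at hlen
        obtain ⟨b, hb⟩ := hS
        obtain ⟨z, hz, -⟩ := hcov hb (hSx' b hb).2 ha.2 le_rfl
        refine ih hd (by omega) ⟨z, hz⟩ (fun z hz => ⟨(hT.1 hz).1, (hT.1 hz).2.1⟩) ?_
        intro z haz hzy
        refine hzy.lt_of_ne ?_
        rintro rfl
        have := h.length_eq hd (.cons haz (.singleton z))
        simp at this
        omega

/-- A chain with `k + 1` elements in the open interval gains the two endpoints and is refined to a
maximal chain. -/
theorem exists_isMaxChainOf_of_le_krullDim {P : Type*} [PartialOrder P] [Finite P] {x y : P}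
    {k : ℕ} (hk : (k : WithBot ℕ∞) ≤ Order.krullDim (Set.Ioo x y)) :
    ∃ c, IsMaxChainOf x y c ∧ k + 3 ≤ c.length := by
  have hext {x y z : P} {c : List P} (hc : IsMaxChainOf x y c) (hyz : y < z) :
      ∃ d, IsMaxChainOf x z d ∧ c.length + 1 ≤ d.length := by
    obtain ⟨d, hd⟩ := exists_isMaxChainOf hyz.le
    refine ⟨_, hc.trans hd, ?_⟩
    obtain ⟨b, d, rfl, -⟩ := hd.exists_of_ne hyz.ne
    simp
  obtain ⟨p, rfl⟩ := Order.le_krullDim_iff.1 hk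
  have key (i : ℕ) (hi : i < p.length + 1) :
      ∃ c, IsMaxChainOf x (p ⟨i, hi⟩ : P) c ∧ i + 2 ≤ c.length := by
    induction i with
    | zero =>
      obtain ⟨d, hd, hl⟩ := hext (.singleton x) (p ⟨0, hi⟩).2.1
      exact ⟨d, hd, hl⟩
    | succ i ih =>
      obtain ⟨c, hc, hl⟩ := ih (by omega)
      obtain ⟨d, hd, hl'⟩ := hext hc
        (p.strictMono (a := ⟨i, by omega⟩) (b := ⟨i + 1, hi⟩) (by simp))
      exact ⟨d, hd, by omega⟩
  obtain ⟨c, hc, hl⟩ := key p.length (by omega)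
  obtain ⟨d, hd, hl'⟩ := hext hc (p ⟨p.length, by omega⟩).2.2
  exact ⟨d, hd, by omega⟩

theorem IsTotallySemimodular.isCohenMacaulay {P : Type*} [PartialOrder P]
    (h : IsTotallySemimodular P) (R : Type*) [CommRing R] : IsCohenMacaulay R P where
  toIsGraded := h.isGraded
  vanishing x y hxy k hk := by
    have := h.finite
    obtain ⟨c, hc, hl⟩ := exists_isMaxChainOf_of_le_krullDim hk
    let S : Finset P := (Set.toFinite {a | x ⋖ a ∧ a ≤ y}).toFinset
    have hS {a : P} : a ∈ S ↔ x ⋖ a ∧ a ≤ y := Set.Finite.mem_toFinset _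
    obtain ⟨a, ha⟩ := exists_covBy_le hxy
    have hIoo : Set.Ioo x y = {q | q < y ∧ ∃ a ∈ S, a ≤ q} := by
      ext q
      constructor
      · rintro ⟨hxq, hqy⟩
        obtain ⟨a, hxa, haq⟩ := exists_covBy_le hxq
        exact ⟨hqy, a, hS.2 ⟨hxa, haq.trans hqy.le⟩, haq⟩
      · rintro ⟨hqy, a, ha, haq⟩
        exact ⟨(hS.1 ha).1.lt.trans_le haq, hqy⟩
    apply IsAcyclicIn.subsingleton_reducedOrderHomology
    rw [hIoo]
    exact h.hasJoinCovers.isAcyclicIn R hc hl ⟨a, hS.2 ha⟩ fun a ha => hS.1 ha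

/-! ### Merging two blocks of a pointed partition -/

namespace PointedPartition

variable {n : ℕ}

instance : Finite (PointedPartition n) :=
  Finite.of_injective
    (fun π : PointedPartition n => ((fun i j => π.partition i j : Fin n → Fin n → Prop), π.pointed))
    fun π ν h => by
      rw [Prod.mk.injEq] at h
      exact PointedPartition.ext (Setoid.ext fun i j => iff_of_eq (congrFun (congrFun h.1 i) j)) h.2

theorem exists_pointed (π : PointedPartition n) (i : Fin n) :
    ∃ p ∈ π.pointed, π.partition p i := by
  obtain ⟨p, hp, -⟩ := π.existsUnique_pointed _ (π.partition.mem_classes i)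
  exact ⟨p, hp.2, hp.1⟩

theorem eq_of_rel (π : PointedPartition n) {p q : Fin n} (hp : p ∈ π.pointed)
    (hq : q ∈ π.pointed) (h : π.partition p q) : p = q :=
  (π.existsUnique_pointed _ (π.partition.mem_classes q)).unique ⟨h, hp⟩
    ⟨π.partition.refl q, hq⟩

/-- Each block of `ν` contains just one pointed element, hence just one block of `π`. So the number
of pointed elements is strictly decreasing and can serve as a corank. -/
theorem eq_of_le_of_pointed_eq {π ν : PointedPartition n} (h : π ≤ ν)
    (hp : π.pointed = ν.pointed) : π = ν := by
  refine PointedPartition.ext (le_antisymm h.1 fun i j hij => ?_) hp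
  obtain ⟨p, hp1, hp2⟩ := π.exists_pointed i
  obtain ⟨q, hq1, hq2⟩ := π.exists_pointed j
  have : p = q := ν.eq_of_rel (hp ▸ hp1) (hp ▸ hq1)
    (ν.partition.trans (h.1 hp2) (ν.partition.trans hij (ν.partition.symm (h.1 hq2))))
  subst this
  exact π.partition.trans (π.partition.symm hp2) hq2

theorem ncard_pointed_lt {π ν : PointedPartition n} (h : π < ν) :
    ν.pointed.ncard < π.pointed.ncard :=
  Set.ncard_lt_ncard (h.le.2.ssubset_of_ne fun e => h.ne (eq_of_le_of_pointed_eq h.le e.symm))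

theorem covBy_of_ncard {π ν : PointedPartition n} (h : π ≤ ν)
    (hc : π.pointed.ncard = ν.pointed.ncard + 1) : π ⋖ ν := by
  refine ⟨h.lt_of_ne fun e => ?_, fun σ h1 h2 => ?_⟩
  · subst e; omega
  · have := ncard_pointed_lt h1
    have := ncard_pointed_lt h2
    omega

/-- The pointed partition obtained from `π` by merging the blocks of the pointed elements `a`
and `b`; the element `a` remains pointed. -/
def merge (π : PointedPartition n) {a b : Fin n} (ha : a ∈ π.pointed) (hb : b ∈ π.pointed)
    (hab : a ≠ b) : PointedPartition n where
  partition :=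
    { r := fun i j => π.partition i j ∨
        (π.partition i a ∨ π.partition i b) ∧ (π.partition j a ∨ π.partition j b)
      iseqv :=
        { refl := fun i => .inl (π.partition.refl i)
          symm := fun h => h.imp π.partition.symm And.symm
          trans := by
            rintro i j k (h | ⟨h1, h2⟩) (h' | ⟨h1', h2'⟩)
            · exact .inl (π.partition.trans h h')
            · exact .inr ⟨h1'.imp (π.partition.trans h) (π.partition.trans h), h2'⟩
            · exact .inr ⟨h1, h2.imp (π.partition.trans (π.partition.symm h'))
                (π.partition.trans (π.partition.symm h'))⟩
            · exact .inr ⟨h1, h2'⟩ } }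
  pointed := π.pointed \ {b}
  existsUnique_pointed := by
    rintro B ⟨j, rfl⟩
    by_cases hj : π.partition j a ∨ π.partition j b
    · refine ⟨a, ⟨.inr ⟨.inl (π.partition.refl a), hj⟩, ha, hab⟩, ?_⟩
      rintro p ⟨hp, hp1, hp2⟩
      have : π.partition p a ∨ π.partition p b := by
        obtain h | h := hp
        · exact hj.imp (π.partition.trans h) (π.partition.trans h)
        · exact h.1
      obtain h | h := this
      · exact π.eq_of_rel hp1 ha h
      · exact absurd (π.eq_of_rel hp1 hb h) hp2
    · obtain ⟨p, hp1, hp2⟩ := π.exists_pointed j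
      refine ⟨p, ⟨.inl hp2, hp1, ?_⟩, ?_⟩
      · rintro rfl
        exact hj (.inr (π.partition.symm hp2))
      · rintro q ⟨hq | hq, hq1, -⟩
        · exact π.eq_of_rel hq1 hp1 (π.partition.trans hq (π.partition.symm hp2))
        · exact absurd hq.2 hj

section merge

variable {π ν : PointedPartition n} {a b : Fin n} (ha : a ∈ π.pointed) (hb : b ∈ π.pointed)
  (hab : a ≠ b)

theorem merge_rel : (π.merge ha hb hab).partition a b :=
  .inr ⟨.inl (π.partition.refl a), .inr (π.partition.refl b)⟩

theorem le_merge : π ≤ π.merge ha hb hab :=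
  ⟨fun _ _ h => .inl h, Set.sdiff_subset⟩

/-- This universal property reduces later comparisons to two facts about `ν`: `a` and `b` share a
block, and `b` is not pointed. -/
theorem merge_le_iff :
    π.merge ha hb hab ≤ ν ↔ π ≤ ν ∧ ν.partition a b ∧ b ∉ ν.pointed := by
  refine ⟨fun h => ⟨(le_merge ha hb hab).trans h, h.1 (merge_rel ha hb hab),
    fun hbν => (h.2 hbν).2 rfl⟩, ?_⟩
  rintro ⟨h, hr, hbν⟩
  refine ⟨?_, fun p hp => ⟨h.2 hp, ?_⟩⟩
  · have key {i : Fin n} (hi : π.partition i a ∨ π.partition i b) : ν.partition i a :=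
      hi.elim (fun hi => h.1 hi) fun hi => ν.partition.trans (h.1 hi) (ν.partition.symm hr)
    rintro i j (hij | ⟨hi, hj⟩)
    · exact h.1 hij
    · exact ν.partition.trans (key hi) (ν.partition.symm (key hj))
  · rintro rfl
    exact hbν hp

theorem ncard_pointed_merge : π.pointed.ncard = (π.merge ha hb hab).pointed.ncard + 1 :=
  (Set.ncard_sdiff_singleton_add_one hb).symm

theorem covBy_merge : π ⋖ π.merge ha hb hab :=
  covBy_of_ncard (le_merge ha hb hab) (ncard_pointed_merge ha hb hab)

end merge

theorem exists_merge_le {π ν : PointedPartition n} (h : π < ν) :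
    ∃ (a b : Fin n) (ha : a ∈ π.pointed) (hb : b ∈ π.pointed) (hab : a ≠ b),
      π.merge ha hb hab ≤ ν := by
  -- Take for `b` a pointed element lost in `ν`, and for `a` the one that `ν` keeps in its block.
  obtain ⟨b, hb, hbν⟩ := Set.exists_of_ssubset
    (h.le.2.ssubset_of_ne fun e => h.ne (eq_of_le_of_pointed_eq h.le e.symm))
  obtain ⟨a, ha, hab⟩ := ν.exists_pointed b
  have hne : a ≠ b := by rintro rfl; exact hbν ha
  exact ⟨a, b, h.le.2 ha, hb, hne, (merge_le_iff _ _ _).2 ⟨h.le, hab, hbν⟩⟩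

theorem exists_eq_merge {π ν : PointedPartition n} (h : π ⋖ ν) :
    ∃ (a b : Fin n) (ha : a ∈ π.pointed) (hb : b ∈ π.pointed) (hab : a ≠ b),
      π.merge ha hb hab = ν := by
  obtain ⟨a, b, ha, hb, hab, hle⟩ := exists_merge_le h.lt
  exact ⟨a, b, ha, hb, hab, hle.eq_of_not_lt (h.2 (covBy_merge ha hb hab).lt)⟩

/-- Here `u` and `v` have equally many pointed elements, so a merge of `u` lying above `v`
automatically covers `v`. -/
theorem exists_covBy_of_merge {t u v y : PointedPartition n} (hu : t ⋖ u) (hv : t ⋖ v)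
    {a b : Fin n} (ha : a ∈ u.pointed) (hb : b ∈ u.pointed) (hab : a ≠ b)
    (hvz : v ≤ u.merge ha hb hab) (hzy : u.merge ha hb hab ≤ y) :
    ∃ z ≤ y, u ⋖ z ∧ v ⋖ z := by
  have key {w : PointedPartition n} (hw : t ⋖ w) : t.pointed.ncard = w.pointed.ncard + 1 := by
    obtain ⟨a, b, ha, hb, hab, rfl⟩ := exists_eq_merge hw
    exact ncard_pointed_merge ha hb hab
  refine ⟨_, hzy, covBy_merge ha hb hab, covBy_of_ncard hvz ?_⟩
  rw [← ncard_pointed_merge ha hb hab]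
  exact Nat.succ_injective ((key hv).symm.trans (key hu))

/-- The blocks of `a`, `b`, `c` are united. In `y` they share a block, and the hypothesis on `c`
allows `a` to be the element kept. -/
theorem exists_covBy_of_same_removed {t y : PointedPartition n} {a b c : Fin n}
    (ha : a ∈ t.pointed) (hb : b ∈ t.pointed) (hc : c ∈ t.pointed) (hab : a ≠ b) (hcb : c ≠ b)
    (hac : a ≠ c) (huy : t.merge ha hb hab ≤ y) (hvy : t.merge hc hb hcb ≤ y)
    (hcy : c ∉ y.pointed) : ∃ z ≤ y, t.merge ha hb hab ⋖ z ∧ t.merge hc hb hcb ⋖ z := by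
  set u := t.merge ha hb hab with hu
  have hau : a ∈ u.pointed := ⟨ha, hab⟩
  have hcu : c ∈ u.pointed := ⟨hc, hcb⟩
  have huz := le_merge hau hcu hac
  refine exists_covBy_of_merge (covBy_merge ha hb hab) (covBy_merge hc hb hcb) hau hcu hac ?_ ?_
  · refine (merge_le_iff _ _ _).2 ⟨(le_merge ha hb hab).trans huz, ?_, fun h => h.1.2 rfl⟩
    exact Setoid.trans' _ (Setoid.symm' _ (merge_rel hau hcu hac)) (huz.1 (merge_rel ha hb hab))
  · refine (merge_le_iff _ _ _).2 ⟨huy, ?_, hcy⟩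
    exact y.partition.trans ((merge_le_iff _ _ _).1 huy).2.1
      (y.partition.symm ((merge_le_iff _ _ _).1 hvy).2.1)

theorem hasJoinCovers (n : ℕ) : HasJoinCovers (PointedPartition n) := by
  intro t u v y huv hu hv huy hvy
  obtain ⟨a, b, ha, hb, hab, rfl⟩ := exists_eq_merge hu
  obtain ⟨c, d, hc, hd, hcd, rfl⟩ := exists_eq_merge hv
  obtain ⟨hty, haby, hby⟩ := (merge_le_iff _ _ _).1 huy
  obtain ⟨-, hcdy, hdy⟩ := (merge_le_iff _ _ _).1 hvy
  by_cases hbd : b = d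
  · subst hbd
    have hac : a ≠ c := by rintro rfl; exact huv rfl
    -- At most one of `a` and `c` is pointed in `y`, as both lie in the block of `b`; the other can
    -- be removed.
    by_cases hcy : c ∈ y.pointed
    · have hay : a ∉ y.pointed := fun hay =>
        hac (y.eq_of_rel hay hcy (y.partition.trans haby (y.partition.symm hcdy)))
      obtain ⟨z, hz, h1, h2⟩ :=
        exists_covBy_of_same_removed hc hb ha hcd hab hac.symm hvy huy hay
      exact ⟨z, hz, h2, h1⟩
    · exact exists_covBy_of_same_removed ha hb hc hab hcd hac huy hvy hcy
  · set u := t.merge ha hb hab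
    have hdu : d ∈ u.pointed := ⟨hd, Ne.symm hbd⟩
    -- In `u` the element `d` is still pointed and has to be absorbed by some `e` so that `c` and
    -- `d` become related. The choice is `e = c` if `c` survives in `u`, and `e = a` if `c = b` was
    -- absorbed by `a ≠ d`. If `c = b` and `a = d`, the same two blocks are merged with opposite
    -- choices, and `e` is the pointed element of their block in `y`.
    obtain ⟨e, heu, hed, hey, hez⟩ : ∃ e ∈ u.pointed, e ≠ d ∧ y.partition e d ∧
        ∀ z : PointedPartition n, u ≤ z → z.partition e d → z.partition c d := by
      by_cases hcb : c = b
      · subst hcb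
        by_cases had : a = d
        · subst had
          obtain ⟨e, he, hea⟩ := y.exists_pointed a
          refine ⟨e, huy.2 he, ?_, hea, fun z hz _ => z.partition.symm (hz.1 (merge_rel ..))⟩
          rintro rfl
          exact hdy he
        · exact ⟨a, ⟨ha, hab⟩, had, y.partition.trans haby hcdy, fun z hz h =>
            z.partition.trans (z.partition.symm (hz.1 (merge_rel ..))) h⟩
      · exact ⟨c, ⟨hc, hcb⟩, hcd, hcdy, fun _ _ h => h⟩
    have huz := le_merge heu hdu hed
    refine exists_covBy_of_merge hu hv heu hdu hed ?_ ((merge_le_iff _ _ _).2 ⟨huy, hey, hdy⟩)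
    exact (merge_le_iff _ _ _).2 ⟨hu.le.trans huz, hez _ huz (merge_rel ..), fun h => h.2 rfl⟩

end PointedPartition

theorem mainTheorem5 (n : ℕ) (hn : 1 ≤ n) (m : PointedPartition n) (hm : IsMax m) :
    IsTotallySemimodular (Set.Icc ⊥ m) ∧
    IsCLShellable (Set.Icc ⊥ m) ∧
    IsCohenMacaulay ℤ (Set.Icc ⊥ m) ∧
    ∀ (K : Type*) [Field K], IsCohenMacaulay K (Set.Icc ⊥ m) := by
  have h : IsTotallySemimodular (Set.Icc ⊥ m) :=
    ((PointedPartition.hasJoinCovers n).Icc ⊥ m).isTotallySemimodular (isFiniteBounded_Icc bot_le)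
  exact ⟨h, h.isCLShellable, h.isCohenMacaulay ℤ, fun K _ => h.isCohenMacaulay K⟩
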